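/- For $1\le p\le 2$ and $n\ge 1$, let $B_p^n=\{x\in\mathbb R^n : |x_1|^p+\dots+|x_n|^p\le 1\}$ and let $V_{p,n}=\mathrm{Vol}|_{B_p^n}/\mathrm{Vol}(B_p^n)$ be the normalised volume measure on $B_p^n$, regarded as a measure on $\mathbb R^n$. For a measurable set $A\subset\mathbb R^n$ let $$V_{p,n}^+(A)=\liminf_{\varepsilon\to 0^+}\frac{V_{p,n}\{x : \mathrm{dist}(x,A)\le\varepsilon\}-V_{p,n}(A)}{\varepsilon}\in[0,+\infty]$$ be its lower Minkowski content, where $\mathrm{dist}$ is the Euclidean distance. There exist universal constants $c,C>0$ such that, for all $1\le p\le 2$, all integers $n\ge 1$ and all measurable sets $A\subset\mathbb R^n$ with $V_{p,n}(A)<\exp(-Cn^{p/2})$, $$V_{p,n}^+(A)\ \ge\ c\,n^{1/p}\,V_{p,n}(A)\,\log^{1-1/p}\frac{1}{V_{p,n}(A)},$$ where the right-hand side is read as $0$ when $V_{p,n}(A)=0$. -/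

import Mathlib

open MeasureTheory Filter Topology
open scoped ENNReal

/-- The unit ball `B_p^n` of `ℓ_p^n`, as a subset of Euclidean space. -/
def lpUnitBall (p : ℝ) (n : ℕ) : Set (EuclideanSpace ℝ (Fin n)) :=
  {x | ∑ i, |x i| ^ p ≤ 1}

/-- The normalised volume measure `V_{p,n}` on `B_p^n`, as a measure on `ℝ^n`. -/
noncomputable def lpBallMeasure (p : ℝ) (n : ℕ) : Measure (EuclideanSpace ℝ (Fin n)) :=
  (volume (lpUnitBall p n))⁻¹ • volume.restrict (lpUnitBall p n)

/-- The lower Minkowski content `μ⁺(A)` associated to `μ`: the lower limit, as `ε → 0+`, of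
`(μ {x | dist(x, A) ≤ ε} - μ(A)) / ε`. It may be infinite. For a finite measure the truncated
subtraction is the true one, since `A` lies in each of its closed thickenings. -/
noncomputable def lowerMinkowskiContent {E : Type*} [PseudoEMetricSpace E] [MeasurableSpace E]
    (μ : Measure E) (A : Set E) : ℝ≥0∞ :=
  liminf (fun ε : ℝ => (μ (Metric.cthickening ε A) - μ A) / ENNReal.ofReal ε) (𝓝[>] (0 : ℝ))

open scoped Pointwise in
theorem volume_add_volume_le_of_add_subset {A B C : Set ℝ} (hA : MeasurableSet A)
    (hB : MeasurableSet B) (hA0 : A.Nonempty) (hB0 : B.Nonempty)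
    (h : ∀ a ∈ A, ∀ b ∈ B, a + b ∈ C) : volume A + volume B ≤ volume C := by
  have key : ∀ K L : Set ℝ, IsCompact K → IsCompact L → K.Nonempty → L.Nonempty → K ⊆ A → L ⊆ B →
      volume K + volume L ≤ volume C := by
    intro K L hK hL hK0 hL0 hKA hLB
    obtain ⟨k, hk, hkm⟩ := hK.exists_isGreatest hK0
    obtain ⟨l, hl, hlm⟩ := hL.exists_isLeast hL0
    have h1 : volume ((fun x => x + l) '' K) = volume K := by
      simp
    have h2 : volume (((fun x => k + x) '' L) \ {k + l}) = volume L := by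
      rw [measure_sdiff_null (measure_singleton _)]
      simp
    rw [← h1, ← h2, ← measure_union]
    · refine measure_mono ?_
      rintro _ (⟨x, hx, rfl⟩ | ⟨⟨x, hx, rfl⟩, -⟩)
      · exact h _ (hKA hx) _ (hLB hl)
      · exact h _ (hKA hk) _ (hLB hx)
    · rw [Set.disjoint_left]
      rintro _ ⟨x, hx, rfl⟩ ⟨⟨y, hy, hxy⟩, hne⟩
      have := hkm hx
      have := hlm hy
      apply hne
      simp only [Set.mem_singleton_iff] at hxy ⊢
      linarith
    · exact ((hL.image (by fun_prop)).measurableSet).diff (measurableSet_singleton _)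
  have exh : ∀ S : Set ℝ, MeasurableSet S → S.Nonempty → ∀ r, (∀ K, IsCompact K → K.Nonempty → K ⊆ S →
      volume K ≤ r) → volume S ≤ r := by
    rintro S hS ⟨s, hs⟩ r hr
    rw [hS.measure_eq_iSup_isCompact]
    refine iSup_le fun K => iSup_le fun hKS => iSup_le fun hK => ?_
    rcases K.eq_empty_or_nonempty with rfl | hne
    · simp
    · exact hr K hK hne hKS
  have step : ∀ L : Set ℝ, IsCompact L → L.Nonempty → L ⊆ B → volume A + volume L ≤ volume C := by
    intro L hL hL0 hLB
    refine (ENNReal.le_sub_iff_add_le_right hL.measure_lt_top.ne ?_).1 ?_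
    · obtain ⟨a, ha⟩ := hA0
      simpa using key {a} L isCompact_singleton hL (Set.singleton_nonempty a) hL0
        (Set.singleton_subset_iff.2 ha) hLB
    · exact exh A hA hA0 _ fun K hK hK0 hKA =>
        ENNReal.le_sub_of_add_le_right hL.measure_lt_top.ne (key K L hK hL hK0 hL0 hKA hLB)
  by_cases hAt : volume A = ∞
  · obtain ⟨b, hb⟩ := hB0
    have := step {b} isCompact_singleton (Set.singleton_nonempty b) (Set.singleton_subset_iff.2 hb)
    simp only [hAt, top_add, top_le_iff] at this
    rw [this]; exact le_top
  · rw [add_comm]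
    refine (ENNReal.le_sub_iff_add_le_right hAt ?_).1 ?_
    · obtain ⟨b, hb⟩ := hB0
      simpa using step {b} isCompact_singleton (Set.singleton_nonempty b)
        (Set.singleton_subset_iff.2 hb)
    · exact exh B hB hB0 _ fun L hL hL0 hLB =>
        ENNReal.le_sub_of_add_le_left hAt (step L hL hL0 hLB)

open scoped Pointwise in
theorem volume_convexCombination_le {A B C : Set ℝ} {t : ℝ} (ht0 : 0 < t) (ht1 : t < 1)
    (hA : MeasurableSet A) (hB : MeasurableSet B) (hA0 : A.Nonempty) (hB0 : B.Nonempty)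
    (h : ∀ a ∈ A, ∀ b ∈ B, (1 - t) * a + t * b ∈ C) :
    ENNReal.ofReal (1 - t) * volume A + ENNReal.ofReal t * volume B ≤ volume C := by
  have h1 : 0 < 1 - t := by linarith
  have e1 : volume ((1 - t) • A) = ENNReal.ofReal (1 - t) * volume A := by
    rw [Measure.addHaar_smul]; simp [abs_of_pos h1]
  have e2 : volume (t • B) = ENNReal.ofReal t * volume B := by
    rw [Measure.addHaar_smul]; simp [abs_of_pos ht0]
  rw [← e1, ← e2]
  refine volume_add_volume_le_of_add_subset (hA.const_smul₀ _) (hB.const_smul₀ _) hA0.smul_set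
    hB0.smul_set ?_
  rintro _ ⟨a, ha, rfl⟩ _ ⟨b, hb, rfl⟩
  exact h a ha b hb

theorem ENNReal.rpow_mul_rpow_le_weighted_add {t : ℝ} (ht0 : 0 < t) (ht1 : t < 1) (x y : ℝ≥0∞) :
    x ^ (1 - t) * y ^ t ≤ ENNReal.ofReal (1 - t) * x + ENNReal.ofReal t * y := by
  have h1 : 0 < 1 - t := by linarith
  have hpq : (1 / (1 - t)).HolderConjugate (1 / t) := by
    refine (Real.holderConjugate_iff).2 ⟨?_, ?_⟩
    · rw [lt_div_iff₀ h1]; linarith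
    · field_simp; ring
  have := ENNReal.young_inequality (x ^ (1 - t)) (y ^ t) hpq
  rw [← ENNReal.rpow_mul, ← ENNReal.rpow_mul, mul_one_div_cancel h1.ne', mul_one_div_cancel ht0.ne',
    ENNReal.rpow_one, ENNReal.rpow_one] at this
  refine this.trans (le_of_eq ?_)
  rw [one_div, one_div, ENNReal.ofReal_inv_of_pos h1, ENNReal.ofReal_inv_of_pos ht0,
    div_eq_mul_inv, div_eq_mul_inv, inv_inv, inv_inv, mul_comm x, mul_comm y]

theorem lintegral_eq_lintegral_meas_lt_toReal {f : ℝ → ℝ≥0∞} (hf : Measurable f)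
    (hf1 : ∀ x, f x ≤ 1) :
    ∫⁻ x, f x = ∫⁻ s in Set.Ioi (0 : ℝ), volume {x | s < (f x).toReal} := by
  rw [← lintegral_eq_lintegral_meas_lt volume (Eventually.of_forall fun x => ENNReal.toReal_nonneg)
    hf.ennreal_toReal.aemeasurable]
  refine lintegral_congr fun x => ?_
  rw [ENNReal.ofReal_toReal ((hf1 x).trans_lt ENNReal.one_lt_top).ne]

theorem prekopaLeindler_of_iSup_eq_one {f g h : ℝ → ℝ≥0∞} {t : ℝ} (ht0 : 0 < t) (ht1 : t < 1)
    (hf : Measurable f) (hg : Measurable g) (hh : Measurable h) (hf1 : ⨆ x, f x = 1)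
    (hg1 : ⨆ x, g x = 1)
    (H : ∀ x y, f x ^ (1 - t) * g y ^ t ≤ h ((1 - t) * x + t * y)) :
    (∫⁻ x, f x) ^ (1 - t) * (∫⁻ x, g x) ^ t ≤ ∫⁻ x, h x := by
  have h1 : 0 < 1 - t := by linarith
  have lef : ∀ x, f x ≤ 1 := fun x => hf1 ▸ le_iSup f x
  have leg : ∀ x, g x ≤ 1 := fun x => hg1 ▸ le_iSup g x
  have hh' : Measurable fun x => min (h x) 1 := hh.min measurable_const
  have H' : ∀ x y, f x ^ (1 - t) * g y ^ t ≤ min (h ((1 - t) * x + t * y)) 1 := fun x y =>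
    le_min (H x y) (mul_le_one' (ENNReal.rpow_le_one (lef x) h1.le)
      (ENNReal.rpow_le_one (leg y) ht0.le))
  refine le_trans (ENNReal.rpow_mul_rpow_le_weighted_add ht0 ht1 _ _) ?_
  refine le_trans ?_ (lintegral_mono (fun x => min_le_left (h x) 1))
  rw [lintegral_eq_lintegral_meas_lt_toReal hf lef, lintegral_eq_lintegral_meas_lt_toReal hg leg,
    lintegral_eq_lintegral_meas_lt_toReal hh' (fun x => min_le_right _ _)]
  rw [← lintegral_const_mul' _ _ ENNReal.ofReal_ne_top, ← lintegral_const_mul' _ _ ENNReal.ofReal_ne_top,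
    ← lintegral_add_left]
  swap
  · refine Measurable.const_mul ?_ _
    refine Antitone.measurable fun a b hab => measure_mono fun x hx => lt_of_le_of_lt hab hx
  refine setLIntegral_mono' measurableSet_Ioi fun s (hs : 0 < s) => ?_
  have lt_iff : ∀ a : ℝ≥0∞, a ≤ 1 → (s < a.toReal ↔ ENNReal.ofReal s < a) := fun a ha =>
    (ENNReal.ofReal_lt_iff_lt_toReal hs.le (ha.trans_lt ENNReal.one_lt_top).ne).symm
  rcases le_or_gt 1 s with hs1 | hs1
  · have : ∀ a : ℝ≥0∞, a ≤ 1 → ¬ s < a.toReal := fun a ha => by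
      rw [lt_iff a ha, not_lt]
      exact ha.trans (ENNReal.one_le_ofReal.2 hs1)
    simp [this _ (lef _), this _ (leg _)]
  · have hs1' : ENNReal.ofReal s < 1 := by simpa using hs1
    refine volume_convexCombination_le ht0 ht1 (measurableSet_lt measurable_const hf.ennreal_toReal)
      (measurableSet_lt measurable_const hg.ennreal_toReal) ?_ ?_ ?_
    · obtain ⟨x, hx⟩ := lt_iSup_iff.1 (hf1 ▸ hs1')
      exact ⟨x, (lt_iff _ (lef x)).2 hx⟩
    · obtain ⟨x, hx⟩ := lt_iSup_iff.1 (hg1 ▸ hs1')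
      exact ⟨x, (lt_iff _ (leg x)).2 hx⟩
    · intro x hx y hy
      have hx' := (lt_iff _ (lef x)).1 hx
      have hy' := (lt_iff _ (leg y)).1 hy
      refine (lt_iff _ (min_le_right _ _)).2 (lt_of_lt_of_le ?_ (H' x y))
      have hs0 : ENNReal.ofReal s ≠ 0 := by simpa using hs
      calc ENNReal.ofReal s = ENNReal.ofReal s ^ (1 - t) * ENNReal.ofReal s ^ t := by
            rw [← ENNReal.rpow_add _ _ hs0 ENNReal.ofReal_ne_top]; simp
        _ < _ := ENNReal.mul_lt_mul (ENNReal.rpow_lt_rpow hx' h1) (ENNReal.rpow_lt_rpow hy' ht0)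

theorem prekopaLeindler_of_iSup_ne_top {f g h : ℝ → ℝ≥0∞} {t : ℝ} (ht0 : 0 < t) (ht1 : t < 1)
    (hf : Measurable f) (hg : Measurable g) (hh : Measurable h) (hf1 : ⨆ x, f x ≠ ∞)
    (hg1 : ⨆ x, g x ≠ ∞)
    (H : ∀ x y, f x ^ (1 - t) * g y ^ t ≤ h ((1 - t) * x + t * y)) :
    (∫⁻ x, f x) ^ (1 - t) * (∫⁻ x, g x) ^ t ≤ ∫⁻ x, h x := by
  have h1 : 0 < 1 - t := by linarith
  set S := ⨆ x, f x with hS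
  set T := ⨆ x, g x with hT
  by_cases hS0 : S = 0
  · have : ∀ x, f x = 0 := by simpa [hS] using hS0
    simp [this, h1]
  by_cases hT0 : T = 0
  · have : ∀ x, g x = 0 := by simpa [hT] using hT0
    simp [this, ht0]
  have hc0 : S ^ (1 - t) * T ^ t ≠ 0 := by simp [hS0, hT0, hf1, hg1]
  have hct : S ^ (1 - t) * T ^ t ≠ ∞ :=
    ENNReal.mul_ne_top (ENNReal.rpow_ne_top_of_nonneg h1.le hf1)
      (ENNReal.rpow_ne_top_of_nonneg ht0.le hg1)
  have key := prekopaLeindler_of_iSup_eq_one (f := fun x => S⁻¹ * f x) (g := fun x => T⁻¹ * g x)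
    (h := fun x => (S ^ (1 - t) * T ^ t)⁻¹ * h x) ht0 ht1 (hf.const_mul _) (hg.const_mul _)
    (hh.const_mul _) (by rw [← ENNReal.mul_iSup, ENNReal.inv_mul_cancel hS0 hf1])
    (by rw [← ENNReal.mul_iSup, ENNReal.inv_mul_cancel hT0 hg1]) ?_
  · rw [lintegral_const_mul _ hf, lintegral_const_mul _ hg, lintegral_const_mul _ hh,
      ENNReal.mul_rpow_of_nonneg _ _ h1.le, ENNReal.mul_rpow_of_nonneg _ _ ht0.le,
      ENNReal.inv_rpow, ENNReal.inv_rpow, mul_mul_mul_comm,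
      ← ENNReal.mul_inv (Or.inr (ENNReal.rpow_ne_top_of_nonneg ht0.le hg1))
        (Or.inl (ENNReal.rpow_ne_top_of_nonneg h1.le hf1))] at key
    exact (ENNReal.mul_le_mul_iff_right (ENNReal.inv_ne_zero.2 hct) (ENNReal.inv_ne_top.2 hc0)).1 key
  · intro x y
    rw [ENNReal.mul_rpow_of_nonneg _ _ h1.le, ENNReal.mul_rpow_of_nonneg _ _ ht0.le,
      ENNReal.inv_rpow, ENNReal.inv_rpow, mul_mul_mul_comm,
      ← ENNReal.mul_inv (Or.inr (ENNReal.rpow_ne_top_of_nonneg ht0.le hg1))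
        (Or.inl (ENNReal.rpow_ne_top_of_nonneg h1.le hf1))]
    gcongr
    exact H x y

theorem lintegral_eq_iSup_lintegral_min_nat {f : ℝ → ℝ≥0∞} (hf : Measurable f) :
    ∫⁻ x, f x = ⨆ k : ℕ, ∫⁻ x, min (f x) k := by
  rw [← lintegral_iSup (fun k => hf.min measurable_const)
    (fun i j hij x => min_le_min le_rfl (by exact_mod_cast hij))]
  refine lintegral_congr fun x => ?_
  rw [← inf_iSup_eq, ENNReal.iSup_natCast, inf_top_eq]

/-- The one-dimensional Prékopa–Leindler inequality. -/
theorem prekopaLeindler {f g h : ℝ → ℝ≥0∞} {t : ℝ} (ht0 : 0 < t) (ht1 : t < 1)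
    (hf : Measurable f) (hg : Measurable g) (hh : Measurable h)
    (H : ∀ x y, f x ^ (1 - t) * g y ^ t ≤ h ((1 - t) * x + t * y)) :
    (∫⁻ x, f x) ^ (1 - t) * (∫⁻ x, g x) ^ t ≤ ∫⁻ x, h x := by
  have h1 : 0 < 1 - t := by linarith
  rw [lintegral_eq_iSup_lintegral_min_nat hf, lintegral_eq_iSup_lintegral_min_nat hg]
  have e : ∀ (u : ℕ → ℝ≥0∞) (r : ℝ), 0 < r → (⨆ k, u k) ^ r = ⨆ k, u k ^ r := fun u r hr =>
    (ENNReal.orderIsoRpow r hr).map_iSup u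
  rw [e _ _ h1, e _ _ ht0, ENNReal.iSup_mul]
  refine iSup_le fun i => ?_
  rw [ENNReal.mul_iSup]
  refine iSup_le fun j => ?_
  refine prekopaLeindler_of_iSup_ne_top ht0 ht1 (hf.min measurable_const) (hg.min measurable_const)
    hh ?_ ?_ ?_
  · exact ((iSup_le fun x => min_le_right _ _).trans_lt (ENNReal.natCast_lt_top i)).ne
  · exact ((iSup_le fun x => min_le_right _ _).trans_lt (ENNReal.natCast_lt_top j)).ne
  · intro x y
    refine le_trans ?_ (H x y)
    gcongr <;> exact min_le_left _ _

/-- The multiplicative Brunn–Minkowski inequality in `Fin n → ℝ`. -/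
theorem brunnMinkowski_pi (n : ℕ) {A B C : Set (Fin n → ℝ)} {t : ℝ} (ht0 : 0 < t) (ht1 : t < 1)
    (hA : MeasurableSet A) (hB : MeasurableSet B) (hC : MeasurableSet C)
    (H : ∀ a ∈ A, ∀ b ∈ B, (1 - t) • a + t • b ∈ C) :
    volume A ^ (1 - t) * volume B ^ t ≤ volume C := by
  have h1 : 0 < 1 - t := by linarith
  induction n with
  | zero =>
    rcases A.eq_empty_or_nonempty with rfl | ⟨a, ha⟩
    · simp [h1]
    rcases B.eq_empty_or_nonempty with rfl | ⟨b, hb⟩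
    · simp [ht0]
    have e : ∀ S : Set (Fin 0 → ℝ), S.Nonempty → volume S = 1 := by
      rintro S ⟨s, hs⟩
      have : S = Set.univ := by ext x; simp [Subsingleton.elim x s, hs]
      rw [this, volume_pi, Measure.pi_of_empty]
      simp
    rw [e A ⟨a, ha⟩, e B ⟨b, hb⟩, e C ⟨_, H a ha b hb⟩]
    simp
  | succ n ih =>
    let e := MeasurableEquiv.piFinSuccAbove (fun _ : Fin (n + 1) => ℝ) 0
    have he : MeasurePreserving e.symm volume volume :=
      (volume_preserving_piFinSuccAbove (fun _ : Fin (n + 1) => ℝ) 0).symm e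
    have hv : ∀ S : Set (Fin (n + 1) → ℝ), MeasurableSet S →
        volume S = ∫⁻ s : ℝ, volume (Prod.mk s ⁻¹' (e.symm ⁻¹' S)) := by
      intro S hS
      rw [← he.measure_preimage_equiv, Measure.volume_eq_prod,
        Measure.prod_apply (e.symm.measurable hS)]
    have hm : ∀ S : Set (Fin (n + 1) → ℝ), MeasurableSet S →
        Measurable fun s : ℝ => volume (Prod.mk s ⁻¹' (e.symm ⁻¹' S)) := fun S hS =>
      measurable_measure_prodMk_left (e.symm.measurable hS)
    rw [hv A hA, hv B hB, hv C hC]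
    refine prekopaLeindler ht0 ht1 (hm A hA) (hm B hB) (hm C hC) fun x y => ?_
    refine ih ?_ ?_ ?_ ?_
    · exact measurable_prodMk_left (e.symm.measurable hA)
    · exact measurable_prodMk_left (e.symm.measurable hB)
    · exact measurable_prodMk_left (e.symm.measurable hC)
    · intro a ha b hb
      have := H _ ha _ hb
      simp only [Set.mem_preimage]
      convert this using 1
      ext i
      refine Fin.cases ?_ (fun j => ?_) i <;>
        simp [e, MeasurableEquiv.piFinSuccAbove_symm_apply, Fin.insertNthEquiv]

/-- The multiplicative Brunn–Minkowski inequality in Euclidean space. -/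
theorem brunnMinkowski {n : ℕ} {A B C : Set (EuclideanSpace ℝ (Fin n))} {t : ℝ} (ht0 : 0 < t)
    (ht1 : t < 1) (hA : MeasurableSet A) (hB : MeasurableSet B) (hC : MeasurableSet C)
    (H : ∀ a ∈ A, ∀ b ∈ B, (1 - t) • a + t • b ∈ C) :
    volume A ^ (1 - t) * volume B ^ t ≤ volume C := by
  have he := (EuclideanSpace.volume_preserving_symm_measurableEquiv_toLp (Fin n)).symm
  rw [← he.measure_preimage_equiv A, ← he.measure_preimage_equiv B, ← he.measure_preimage_equiv C]
  refine brunnMinkowski_pi n ht0 ht1 ((MeasurableEquiv.measurable _) hA)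
    ((MeasurableEquiv.measurable _) hB) ((MeasurableEquiv.measurable _) hC) ?_
  intro a ha b hb
  exact H _ ha _ hb

theorem measurableSet_lpUnitBall (p : ℝ) (n : ℕ) : MeasurableSet (lpUnitBall p n) := by
  unfold lpUnitBall
  exact measurableSet_le (by fun_prop) measurable_const

theorem convex_lpUnitBall {p : ℝ} (hp : 1 ≤ p) (n : ℕ) : Convex ℝ (lpUnitBall p n) := by
  have : ConvexOn ℝ Set.univ fun x : EuclideanSpace ℝ (Fin n) => ∑ i, |x i| ^ p := by
    refine ⟨convex_univ, fun x _ y _ a b ha hb hab => ?_⟩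
    simp only [smul_eq_mul, Finset.mul_sum, ← Finset.sum_add_distrib]
    refine Finset.sum_le_sum fun i _ => ?_
    refine le_trans ?_ ((convexOn_rpow hp).2 (abs_nonneg (x i)) (abs_nonneg (y i)) ha hb hab)
    refine Real.rpow_le_rpow (abs_nonneg _) ?_ (by linarith)
    simp only [PiLp.add_apply, PiLp.smul_apply, smul_eq_mul]
    refine (abs_add_le _ _).trans ?_
    rw [abs_mul, abs_mul, abs_of_nonneg ha, abs_of_nonneg hb]
  simpa [lpUnitBall] using this.convex_le 1

theorem volume_lpUnitBall {p : ℝ} (hp : 1 ≤ p) {n : ℕ} (hn : 1 ≤ n) :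
    volume (lpUnitBall p n) =
      ENNReal.ofReal ((2 * Real.Gamma (1 / p + 1)) ^ n / Real.Gamma (n / p + 1)) := by
  have : Nonempty (Fin n) := ⟨⟨0, hn⟩⟩
  have h := volume_sum_rpow_le (ι := Fin n) hp 1
  rw [Fintype.card_fin, ENNReal.ofReal_one, one_pow, one_mul] at h
  rw [← h]
  have he := (EuclideanSpace.volume_preserving_symm_measurableEquiv_toLp (Fin n))
  rw [← he.measure_preimage_equiv]
  congr 1
  ext x
  have h0 : 0 ≤ ∑ i, |x i| ^ p := Finset.sum_nonneg fun i _ => Real.rpow_nonneg (abs_nonneg _) _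
  simp only [lpUnitBall, Set.mem_ofPred_eq, Set.mem_preimage]
  have e1 : ∑ i, |(MeasurableEquiv.toLp 2 (Fin n → ℝ)).symm x i| ^ p = ∑ i, |x i| ^ p := rfl
  rw [e1]
  have := Real.rpow_le_rpow_iff h0 zero_le_one (one_div_pos.2 (by linarith : 0 < p))
  rw [Real.one_rpow] at this
  exact this.symm

theorem volume_lpUnitBall_ne_zero {p : ℝ} (hp : 1 ≤ p) {n : ℕ} (hn : 1 ≤ n) :
    volume (lpUnitBall p n) ≠ 0 := by
  have : 0 < p := by linarith
  rw [volume_lpUnitBall hp hn]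
  simp only [ne_eq, ENNReal.ofReal_eq_zero, not_le]
  have h1 := Real.Gamma_pos_of_pos (by positivity : 0 < 1 / p + 1)
  have h2 := Real.Gamma_pos_of_pos (by positivity : 0 < n / p + 1)
  positivity

theorem volume_lpUnitBall_ne_top {p : ℝ} (hp : 1 ≤ p) {n : ℕ} (hn : 1 ≤ n) :
    volume (lpUnitBall p n) ≠ ∞ := by
  rw [volume_lpUnitBall hp hn]
  exact ENNReal.ofReal_ne_top

theorem lpBallMeasure_apply (p : ℝ) (n : ℕ) (S : Set (EuclideanSpace ℝ (Fin n))) :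
    lpBallMeasure p n S = (volume (lpUnitBall p n))⁻¹ * volume (S ∩ lpUnitBall p n) := by
  rw [lpBallMeasure, Measure.smul_apply, Measure.restrict_apply' (measurableSet_lpUnitBall p n),
    smul_eq_mul]

theorem isProbabilityMeasure_lpBallMeasure {p : ℝ} (hp : 1 ≤ p) {n : ℕ} (hn : 1 ≤ n) :
    IsProbabilityMeasure (lpBallMeasure p n) := by
  refine ⟨?_⟩
  rw [lpBallMeasure_apply, Set.univ_inter]
  exact ENNReal.inv_mul_cancel (volume_lpUnitBall_ne_zero hp hn) (volume_lpUnitBall_ne_top hp hn)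

theorem lpBallMeasure_brunnMinkowski {p : ℝ} (hp : 1 ≤ p) {n : ℕ} (hn : 1 ≤ n)
    {A B C : Set (EuclideanSpace ℝ (Fin n))} {t : ℝ} (ht0 : 0 < t) (ht1 : t < 1)
    (hA : NullMeasurableSet A volume) (hB : MeasurableSet B) (hC : MeasurableSet C)
    (H : ∀ a ∈ A ∩ lpUnitBall p n, ∀ b ∈ B ∩ lpUnitBall p n, (1 - t) • a + t • b ∈ C) :
    (lpBallMeasure p n).real A ^ (1 - t) * (lpBallMeasure p n).real B ^ t ≤
      (lpBallMeasure p n).real C := by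
  have h1 : 0 < 1 - t := by linarith
  have hm := measurableSet_lpUnitBall p n
  have hprob := isProbabilityMeasure_lpBallMeasure hp hn
  obtain ⟨A', hA'A, hA', hAe⟩ := (hA.inter hm.nullMeasurableSet).exists_measurable_subset_ae_eq
  have key := brunnMinkowski ht0 ht1 hA' (hB.inter hm) (hC.inter hm) fun a ha b hb =>
    ⟨H a (hA'A ha) b hb, convex_lpUnitBall hp n (hA'A ha).2 hb.2 h1.le ht0.le (by ring)⟩
  rw [measure_congr hAe] at key
  have hw0 : (volume (lpUnitBall p n))⁻¹ ≠ 0 := ENNReal.inv_ne_zero.2 (volume_lpUnitBall_ne_top hp hn)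
  have hwt : (volume (lpUnitBall p n))⁻¹ ≠ ∞ := ENNReal.inv_ne_top.2 (volume_lpUnitBall_ne_zero hp hn)
  have key' : lpBallMeasure p n A ^ (1 - t) * lpBallMeasure p n B ^ t ≤ lpBallMeasure p n C := by
    rw [lpBallMeasure_apply, lpBallMeasure_apply, lpBallMeasure_apply,
      ENNReal.mul_rpow_of_nonneg _ _ h1.le, ENNReal.mul_rpow_of_nonneg _ _ ht0.le, mul_mul_mul_comm,
      ← ENNReal.rpow_add _ _ hw0 hwt, sub_add_cancel, ENNReal.rpow_one]
    gcongr
  have := ENNReal.toReal_mono (measure_ne_top _ _) key'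
  rwa [ENNReal.toReal_mul, ← ENNReal.toReal_rpow, ← ENNReal.toReal_rpow] at this

/-- A lower bound for the Minkowski content of a set, in terms of its part in a centred Euclidean
ball. -/
theorem le_lowerMinkowskiContent_lpBallMeasure {p : ℝ} (hp : 1 ≤ p) {n : ℕ} (hn : 1 ≤ n)
    {A : Set (EuclideanSpace ℝ (Fin n))} (hA : NullMeasurableSet A volume) {R : ℝ} (hR : 0 < R)
    (hpos : 0 < (lpBallMeasure p n).real (A ∩ Metric.closedBall 0 R)) :
    ENNReal.ofReal ((lpBallMeasure p n).real (A ∩ Metric.closedBall 0 R) *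
        Real.log ((lpBallMeasure p n).real (Metric.closedBall 0 R) /
          (lpBallMeasure p n).real (A ∩ Metric.closedBall 0 R)) / (2 * R)) ≤
      lowerMinkowskiContent (lpBallMeasure p n) A := by
  have hprob := isProbabilityMeasure_lpBallMeasure hp hn
  set μ := lpBallMeasure p n with hμ
  set K := Metric.closedBall (0 : EuclideanSpace ℝ (Fin n)) R with hK
  have hKm : MeasurableSet K := Metric.isClosed_closedBall.measurableSet
  set a := μ.real (A ∩ K) with ha
  have hAμ : NullMeasurableSet A μ :=
    hA.mono_ac (Measure.smul_absolutelyContinuous.trans Measure.absolutelyContinuous_restrict)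
  have hak : a ≤ μ.real K := measureReal_mono Set.inter_subset_right
  have hk : 0 < μ.real K := hpos.trans_le hak
  set l := Real.log (μ.real K / a) with hl
  refine Filter.le_liminf_of_le (by isBoundedDefault) ?_
  filter_upwards [Ioo_mem_nhdsGT (by positivity : (0 : ℝ) < 2 * R)] with ε hε
  set t := ε / (2 * R) with ht
  have ht0 : 0 < t := div_pos hε.1 (by positivity)
  have ht1 : t < 1 := (div_lt_one (by positivity)).2 hε.2
  have hcm : MeasurableSet (Metric.cthickening ε A) := Metric.isClosed_cthickening.measurableSet
  have hbm := lpBallMeasure_brunnMinkowski hp hn ht0 ht1 (hA.inter hKm.nullMeasurableSet) hKm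
    (hcm.inter hKm) (by
      rintro x ⟨⟨hxA, hxK⟩, -⟩ y ⟨hyK, -⟩
      refine ⟨Metric.mem_cthickening_of_dist_le _ x _ _ hxA ?_,
        convex_closedBall _ _ hxK hyK (by linarith) ht0.le (by ring)⟩
      have e : (1 - t) • x + t • y - x = t • (y - x) := by module
      rw [dist_eq_norm, e, norm_smul, Real.norm_of_nonneg ht0.le]
      have h1 : ‖y - x‖ ≤ 2 * R := by
        refine (norm_sub_le _ _).trans ?_
        rw [hK, mem_closedBall_zero_iff] at hxK hyK
        linarith
      calc t * ‖y - x‖ ≤ t * (2 * R) := by gcongr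
        _ = ε := by rw [ht]; field_simp)
  have e1 : a ^ (1 - t) * μ.real K ^ t = a * Real.exp (t * l) := by
    rw [hl, Real.log_div hk.ne' hpos.ne', Real.rpow_def_of_pos hpos, Real.rpow_def_of_pos hk,
      ← Real.exp_add]
    have e2 : ∀ s, a * Real.exp s = Real.exp (Real.log a + s) := fun s => by
      rw [Real.exp_add, Real.exp_log hpos]
    rw [e2]
    ring_nf
  have h2 : a * (t * l) + a ≤ μ.real (Metric.cthickening ε A ∩ K) := by
    refine le_trans ?_ (e1 ▸ hbm)
    nlinarith [Real.add_one_le_exp (t * l)]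
  have h3 : μ (Metric.cthickening ε A ∩ K) - μ (A ∩ K) ≤ μ (Metric.cthickening ε A) - μ A := by
    rw [← measure_sdiff (Metric.self_subset_cthickening A) hAμ (measure_ne_top _ _)]
    refine le_measure_sdiff.trans (measure_mono ?_)
    rintro x ⟨⟨hx, hxK⟩, hx'⟩
    exact ⟨hx, fun h => hx' ⟨h, hxK⟩⟩
  refine le_trans ?_ (ENNReal.div_le_div_right h3 _)
  rw [ENNReal.le_div_iff_mul_le (Or.inl (by simpa using hε.1)) (Or.inl ENNReal.ofReal_ne_top),
    ← ENNReal.ofReal_mul' hε.1.le, ← ofReal_measureReal, ← ofReal_measureReal,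
    ← ENNReal.ofReal_sub _ measureReal_nonneg]
  refine ENNReal.ofReal_le_ofReal ?_
  have e2 : a * l / (2 * R) * ε = a * (t * l) := by rw [ht]; ring
  rw [e2]
  linarith

theorem Real.rpow_add_add_rpow_le {q c a b : ℝ} (hq0 : 0 ≤ q) (hq1 : q ≤ 1) (hc : 0 ≤ c)
    (ha : 0 ≤ a) (hb : 0 ≤ b) : (c + a + b) ^ q + c ^ q ≤ (c + a) ^ q + (c + b) ^ q := by
  rcases (add_nonneg ha hb).eq_or_lt with h | h
  · obtain rfl : a = 0 := by linarith
    obtain rfl : b = 0 := by linarith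
    simp
  have hcv := Real.concaveOn_rpow hq0 hq1
  have hm1 : c ∈ Set.Ici (0 : ℝ) := hc
  have hm2 : c + a + b ∈ Set.Ici (0 : ℝ) := by simp only [Set.mem_Ici]; positivity
  have h1 := hcv.2 hm1 hm2 (div_nonneg hb h.le) (div_nonneg ha h.le)
    (by field_simp; ring)
  have h2 := hcv.2 hm1 hm2 (div_nonneg ha h.le) (div_nonneg hb h.le)
    (by field_simp)
  have e1 : (b / (a + b)) • c + (a / (a + b)) • (c + a + b) = c + a := by
    simp only [smul_eq_mul]; field_simp; ring
  have e2 : (a / (a + b)) • c + (b / (a + b)) • (c + a + b) = c + b := by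
    simp only [smul_eq_mul]; field_simp; ring
  rw [e1] at h1
  rw [e2] at h2
  have e3 : b / (a + b) = 1 - a / (a + b) := by field_simp; ring
  rw [e3] at h1 h2
  simp only [smul_eq_mul] at h1 h2
  linarith

theorem Real.add_sum_rpow_sub_le {ι : Type*} (F : Finset ι) {q c : ℝ} (hq0 : 0 ≤ q) (hq1 : q ≤ 1)
    (hc : 0 ≤ c) (s : ι → ℝ) (hs : ∀ i, 0 ≤ s i) :
    (c + ∑ i ∈ F, s i) ^ q - c ^ q ≤ ∑ i ∈ F, ((c + s i) ^ q - c ^ q) := by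
  classical
  induction F using Finset.induction_on with
  | empty => simp
  | insert i F hi ih =>
    rw [Finset.sum_insert hi, Finset.sum_insert hi]
    have := Real.rpow_add_add_rpow_le hq0 hq1 hc (hs i) (Finset.sum_nonneg fun j _ => hs j : 0 ≤ ∑ j ∈ F, s j)
    rw [add_assoc] at this
    linarith

theorem Real.add_rpow_sub_le_rpow {q c s : ℝ} (hq0 : 0 ≤ q) (hq1 : q ≤ 1) (hc : 0 ≤ c)
    (hs : 0 ≤ s) : (c + s) ^ q - c ^ q ≤ s ^ q := by
  linarith [Real.rpow_add_le_add_rpow hc hs hq0 hq1]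

theorem Real.add_rpow_sub_le_mul {q c s : ℝ} (hq1 : q ≤ 1) (hc : 0 < c)
    (hs : 0 ≤ s) : (c + s) ^ q - c ^ q ≤ c ^ (q - 1) * s := by
  have e : c + s = c * (1 + s / c) := by field_simp
  have h1 : (1 : ℝ) ≤ 1 + s / c := by have := div_nonneg hs hc.le; linarith
  have h2 : (1 + s / c) ^ q ≤ 1 + s / c := by
    simpa using Real.rpow_le_rpow_of_exponent_le h1 hq1
  rw [e, Real.mul_rpow hc.le (by linarith), Real.rpow_sub_one hc.ne']
  have := Real.rpow_nonneg hc.le q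
  calc c ^ q * (1 + s / c) ^ q - c ^ q ≤ c ^ q * (1 + s / c) - c ^ q := by gcongr
    _ = c ^ q / c * s := by field_simp; ring

theorem integrable_comp_abs_of_integrableOn_Ioi {f : ℝ → ℝ} (hf : IntegrableOn f (Set.Ioi 0)) :
    Integrable fun x => f |x| := by
  have h1 : IntegrableOn (fun x => f |x|) (Set.Ioi 0) := by
    refine hf.congr_fun (fun x hx => ?_) measurableSet_Ioi
    simp only [abs_of_pos (Set.mem_Ioi.1 hx)]
  have h2 : IntegrableOn (fun x => f |x|) (Set.Iic 0) := by
    rw [← Measure.map_neg_eq_self (volume : Measure ℝ)]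
    let m : MeasurableEmbedding fun x : ℝ => -x := (Homeomorph.neg ℝ).measurableEmbedding
    rw [m.integrableOn_map_iff]
    simp_rw [Function.comp_def, abs_neg, Set.neg_preimage, Set.neg_Iic, neg_zero]
    exact Iff.mpr integrableOn_Ici_iff_integrableOn_Ioi h1
  rw [← integrableOn_univ, ← Set.Iic_union_Ioi (a := (0 : ℝ))]
  exact h2.union h1

theorem integrable_exp_neg_abs_rpow {p : ℝ} (hp : 0 < p) :
    Integrable fun x : ℝ => Real.exp (-|x| ^ p) := by
  refine integrable_comp_abs_of_integrableOn_Ioi (f := fun x => Real.exp (-x ^ p)) ?_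
  simpa using integrableOn_rpow_mul_exp_neg_rpow (s := 0) (by norm_num) hp

theorem integral_exp_neg_abs_rpow {p : ℝ} (hp : 0 < p) :
    ∫ x : ℝ, Real.exp (-|x| ^ p) = 2 * Real.Gamma (1 / p + 1) := by
  rw [integral_comp_abs (f := fun x => Real.exp (-x ^ p)), integral_exp_neg_rpow hp]

theorem two_thirds_le_integral_exp_neg_abs_rpow {p : ℝ} (hp : 0 < p) :
    2 / 3 ≤ ∫ x : ℝ, Real.exp (-|x| ^ p) := by
  have h1 : ∫ x in Set.Icc (-1 : ℝ) 1, Real.exp (-1) ≤ ∫ x in Set.Icc (-1 : ℝ) 1, Real.exp (-|x| ^ p) := by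
    refine setIntegral_mono_on (by simp) (integrable_exp_neg_abs_rpow hp).integrableOn
      measurableSet_Icc fun x hx => ?_
    have := Real.rpow_le_one (abs_nonneg x) (abs_le.2 hx) hp.le
    gcongr
  have h2 : ∫ x in Set.Icc (-1 : ℝ) 1, Real.exp (-|x| ^ p) ≤ ∫ x : ℝ, Real.exp (-|x| ^ p) :=
    setIntegral_le_integral (integrable_exp_neg_abs_rpow hp)
      (Eventually.of_forall fun x => (Real.exp_pos _).le)
  refine le_trans ?_ (h1.trans h2)
  simp only [integral_const, MeasurableSet.univ, measureReal_restrict_apply, Set.univ_inter,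
    Real.volume_real_Icc, smul_eq_mul]
  have h3 : (1 : ℝ) / 3 ≤ Real.exp (-1) := by
    rw [Real.exp_neg, one_div]
    exact inv_anti₀ (Real.exp_pos _) (by linarith [Real.exp_one_lt_d9])
  norm_num
  linarith

theorem integrable_sq_mul_exp_neg_half_abs :
    Integrable fun x : ℝ => |x| ^ 2 * Real.exp (-(1 / 2) * |x|) := by
  refine integrable_comp_abs_of_integrableOn_Ioi (f := fun x => x ^ 2 * Real.exp (-(1 / 2) * x)) ?_
  have := integrableOn_rpow_mul_exp_neg_mul_rpow (p := 1) (s := 2) (b := 1 / 2) (by norm_num) (by norm_num)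
    (by norm_num)
  simpa using this

theorem integral_sq_mul_exp_neg_half_abs :
    ∫ x : ℝ, |x| ^ 2 * Real.exp (-(1 / 2) * |x|) = 32 := by
  rw [integral_comp_abs (f := fun x => x ^ 2 * Real.exp (-(1 / 2) * x))]
  have := Real.integral_rpow_mul_exp_neg_mul_Ioi (a := 3) (r := 1 / 2) (by norm_num) (by norm_num)
  have e : ∫ x in Set.Ioi (0 : ℝ), x ^ 2 * Real.exp (-(1 / 2) * x) = 16 := by
    have h3 : Real.Gamma 3 = 2 := by simp
    rw [h3] at this
    convert this using 1
    · refine setIntegral_congr_fun measurableSet_Ioi fun x hx => ?_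
      norm_num
    · norm_num
  rw [e]; norm_num

/-- One-dimensional exponential moment bound. -/
theorem integrable_and_integral_exp_le {p c : ℝ} (hp1 : 1 ≤ p) (hp2 : p ≤ 2) (hc : 0 < c) :
    Integrable (fun x : ℝ => Real.exp (-|x| ^ p + ((c + x ^ 2) ^ (p / 2) - c ^ (p / 2)) / 2)) ∧
    ∫ x : ℝ, Real.exp (-|x| ^ p + ((c + x ^ 2) ^ (p / 2) - c ^ (p / 2)) / 2) ≤
      2 * Real.Gamma (1 / p + 1) * (1 + 48 * c ^ (p / 2 - 1)) := by
  have hp0 : 0 < p := by linarith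
  set Z := ∫ x : ℝ, Real.exp (-|x| ^ p) with hZ
  have hcq : 0 ≤ c ^ (p / 2 - 1) := Real.rpow_nonneg hc.le _
  have hD : Integrable fun x : ℝ => Real.exp (-|x| ^ p) +
      c ^ (p / 2 - 1) * (|x| ^ 2 * Real.exp (-(1 / 2) * |x|)) :=
    (integrable_exp_neg_abs_rpow hp0).add (integrable_sq_mul_exp_neg_half_abs.const_mul _)
  have hle : ∀ x : ℝ, Real.exp (-|x| ^ p + ((c + x ^ 2) ^ (p / 2) - c ^ (p / 2)) / 2) ≤
      Real.exp (-|x| ^ p) + c ^ (p / 2 - 1) * (|x| ^ 2 * Real.exp (-(1 / 2) * |x|)) := by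
    intro x
    set u := (c + x ^ 2) ^ (p / 2) - c ^ (p / 2) with hu
    have hu1 : u ≤ |x| ^ p := by
      refine (Real.add_rpow_sub_le_rpow (by linarith) (by linarith) hc.le (sq_nonneg x)).trans ?_
      rw [← sq_abs, ← Real.rpow_natCast, ← Real.rpow_mul (abs_nonneg x)]
      norm_num
      rw [mul_div_cancel₀ _ (two_ne_zero)]
    have hu2 : u ≤ c ^ (p / 2 - 1) * |x| ^ 2 := by
      rw [sq_abs]
      exact Real.add_rpow_sub_le_mul (by linarith) hc (sq_nonneg x)
    have hx1 : |x| - 1 ≤ |x| ^ p := by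
      rcases le_total |x| 1 with h | h
      · linarith [Real.rpow_nonneg (abs_nonneg x) p]
      · have := Real.rpow_le_rpow_of_exponent_le h hp1
        rw [Real.rpow_one] at this
        linarith
    have h1 : Real.exp (-|x| ^ p + u / 2) - Real.exp (-|x| ^ p) ≤ u / 2 * Real.exp (-|x| ^ p + u / 2) := by
      have := Real.add_one_le_exp (-(u / 2))
      have e : Real.exp (-|x| ^ p) = Real.exp (-|x| ^ p + u / 2) * Real.exp (-(u / 2)) := by
        rw [← Real.exp_add]; ring_nf
      nlinarith [Real.exp_pos (-|x| ^ p + u / 2)]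
    have hu0 : 0 ≤ u := by
      have := Real.rpow_le_rpow hc.le (by linarith [sq_nonneg x] : c ≤ c + x ^ 2)
        (by linarith : 0 ≤ p / 2)
      linarith
    have h2 : Real.exp (-|x| ^ p + u / 2) ≤ 2 * Real.exp (-(1 / 2) * |x|) := by
      have : Real.exp (-|x| ^ p + u / 2) ≤ Real.exp (1 / 2) * Real.exp (-(1 / 2) * |x|) := by
        rw [← Real.exp_add]
        refine Real.exp_le_exp.2 ?_
        linarith
      refine this.trans ?_
      gcongr
      have h4 : Real.exp (1 / 2) * Real.exp (1 / 2) = Real.exp 1 := by rw [← Real.exp_add]; norm_num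
      nlinarith [Real.exp_one_lt_d9, Real.exp_pos (1 / 2)]
    have h3 : u / 2 * Real.exp (-|x| ^ p + u / 2) ≤
        (c ^ (p / 2 - 1) * |x| ^ 2) / 2 * (2 * Real.exp (-(1 / 2) * |x|)) := by
      gcongr
    linarith
  have hint : Integrable
      (fun x : ℝ => Real.exp (-|x| ^ p + ((c + x ^ 2) ^ (p / 2) - c ^ (p / 2)) / 2)) := by
    refine hD.mono' (by fun_prop) (Eventually.of_forall fun x => ?_)
    rw [Real.norm_of_nonneg (Real.exp_pos _).le]
    exact hle x
  refine ⟨hint, (integral_mono hint hD hle).trans ?_⟩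
  rw [integral_add (integrable_exp_neg_abs_rpow hp0) (integrable_sq_mul_exp_neg_half_abs.const_mul _),
    integral_const_mul, integral_sq_mul_exp_neg_half_abs, ← integral_exp_neg_abs_rpow hp0, ← hZ]
  have := two_thirds_le_integral_exp_neg_abs_rpow hp0
  rw [← hZ] at this
  nlinarith

/-- A crude form of Stirling's upper bound for the Gamma function. -/
theorem Real.Gamma_add_one_le {m : ℝ} (hm : 0 < m) :
    Real.Gamma (m + 1) ≤ (m + 1) * Real.exp 1 * (m ^ m * Real.exp (-m)) := by
  set d := 1 / (m + 1) with hd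
  have hd0 : 0 < d := by positivity
  have hle : ∀ s ∈ Set.Ioi (0 : ℝ), Real.exp (-s) * s ^ (m + 1 - 1) ≤
      Real.exp (-d * s) * (Real.exp 1 * (m ^ m * Real.exp (-m))) := by
    intro s hs
    have hs : 0 < s := hs
    rw [add_sub_cancel_right, Real.rpow_def_of_pos hs, Real.rpow_def_of_pos hm, ← Real.exp_add,
      ← Real.exp_add, ← Real.exp_add, ← Real.exp_add]
    refine Real.exp_le_exp.2 ?_
    have h1 : Real.log (s / (m + 1)) ≤ s / (m + 1) - 1 := Real.log_le_sub_one_of_pos (by positivity)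
    have h2 : Real.log ((m + 1) / m) ≤ (m + 1) / m - 1 := Real.log_le_sub_one_of_pos (by positivity)
    rw [Real.log_div (by positivity) (by positivity)] at h1 h2
    have h3 : m * ((m + 1) / m - 1) = 1 := by field_simp; ring
    have h4 : -d * s = -s + m * (s / (m + 1)) := by rw [hd]; field_simp; ring
    rw [h4]
    nlinarith [mul_le_mul_of_nonneg_left h1 hm.le, mul_le_mul_of_nonneg_left h2 hm.le]
  have hi : IntegrableOn (fun s : ℝ => Real.exp (-d * s)) (Set.Ioi 0) :=
    integrableOn_exp_mul_Ioi (by linarith) 0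
  rw [Real.Gamma_eq_integral (by linarith)]
  refine (setIntegral_mono_on (Real.GammaIntegral_convergent (by linarith)) (hi.mul_const _)
    measurableSet_Ioi hle).trans (le_of_eq ?_)
  rw [integral_mul_const, integral_exp_mul_Ioi (by linarith) 0]
  simp [hd]
  ring

theorem Real.natCast_add_one_le_exp {n : ℕ} (hn : 1 ≤ n) {q : ℝ} (hq : 1 / 2 ≤ q) :
    (n : ℝ) + 1 ≤ Real.exp (2 * (n : ℝ) ^ q) := by
  have hn' : (1 : ℝ) ≤ n := by exact_mod_cast hn
  have h1 : √(n : ℝ) ≤ (n : ℝ) ^ q := by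
    rw [Real.sqrt_eq_rpow]
    exact Real.rpow_le_rpow_of_exponent_le hn' hq
  have h2 := Real.add_one_le_exp (√(n : ℝ))
  have h3 := Real.sq_sqrt (by linarith : (0 : ℝ) ≤ n)
  have h4 := Real.sqrt_nonneg (n : ℝ)
  calc (n : ℝ) + 1 ≤ (√(n : ℝ) + 1) ^ 2 := by nlinarith
    _ ≤ Real.exp (√(n : ℝ)) ^ 2 := by gcongr
    _ = Real.exp (2 * √(n : ℝ)) := by rw [← Real.exp_nat_mul]; norm_num
    _ ≤ _ := by gcongr

/-- Exponential Chebyshev bound for the part of the `ℓ_p` ball outside a Euclidean ball. -/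
theorem volume_lpUnitBall_inter_le {p : ℝ} (hp1 : 1 ≤ p) (hp2 : p ≤ 2) {n : ℕ} (hn : 1 ≤ n)
    {R : ℝ} (hR : 0 ≤ R) {b : ℝ} (hb : 0 < b) :
    (volume ({x | R < ‖x‖} ∩ lpUnitBall p n)).toReal ≤
      Real.exp (b ^ p - (((n : ℝ) + (b * R) ^ 2) ^ (p / 2) - (n : ℝ) ^ (p / 2)) / 2) *
        (b⁻¹ * (2 * Real.Gamma (1 / p + 1) * (1 + 48 * (n : ℝ) ^ (p / 2 - 1)))) ^ n := by
  have hn' : (0 : ℝ) < n := by exact_mod_cast hn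
  have hp0 : 0 < p := by linarith
  set f : ℝ → ℝ := fun x =>
    Real.exp (-|x| ^ p + (((n : ℝ) + x ^ 2) ^ (p / 2) - (n : ℝ) ^ (p / 2)) / 2) with hf
  set K := Real.exp (b ^ p - (((n : ℝ) + (b * R) ^ 2) ^ (p / 2) - (n : ℝ) ^ (p / 2)) / 2) with hK
  obtain ⟨hfi, hfJ⟩ := integrable_and_integral_exp_le hp1 hp2 hn'
  have hfb : Integrable fun x => f (b * x) := (integrable_comp_mul_left_iff f hb.ne').2 hfi
  have hG : Integrable fun x : Fin n → ℝ => K * ∏ i, f (b * x i) :=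
    (Integrable.fintype_prod (μ := fun _ : Fin n => (volume : Measure ℝ)) fun _ => hfb).const_mul K
  have hGnn : ∀ x : Fin n → ℝ, 0 ≤ K * ∏ i, f (b * x i) := fun x =>
    mul_nonneg (Real.exp_pos _).le (Finset.prod_nonneg fun i _ => (Real.exp_pos _).le)
  have hmarkov := mul_meas_ge_le_integral_of_nonneg (Eventually.of_forall hGnn) hG 1
  have hfin := hG.measure_ge_lt_top one_pos
  have hsub : (MeasurableEquiv.toLp 2 (Fin n → ℝ)) ⁻¹' ({x | R < ‖x‖} ∩ lpUnitBall p n) ⊆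
      {x : Fin n → ℝ | 1 ≤ K * ∏ i, f (b * x i)} := by
    rintro x ⟨hxR, hxB⟩
    replace hxB : ∑ i, |x i| ^ p ≤ 1 := hxB
    replace hxR : R ^ 2 ≤ ∑ i, x i ^ 2 := by
      have h1 : R < ‖(WithLp.toLp 2 x : EuclideanSpace ℝ (Fin n))‖ := hxR
      have h2 := EuclideanSpace.real_norm_sq_eq (WithLp.toLp 2 x : EuclideanSpace ℝ (Fin n))
      simp only at h2
      rw [← h2]
      gcongr
    change 1 ≤ K * ∏ i, f (b * x i)
    rw [hK, hf, ← Real.exp_sum, ← Real.exp_add]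
    refine Real.one_le_exp ?_
    rw [Finset.sum_add_distrib, Finset.sum_neg_distrib, ← Finset.sum_div]
    have h1 : ∑ i, |b * x i| ^ p ≤ b ^ p := by
      have : ∀ i, |b * x i| ^ p = b ^ p * |x i| ^ p := fun i => by
        rw [abs_mul, abs_of_pos hb, Real.mul_rpow hb.le (abs_nonneg _)]
      simp_rw [this]
      rw [← Finset.mul_sum]
      exact mul_le_of_le_one_right (Real.rpow_nonneg hb.le _) hxB
    have h2 := Real.add_sum_rpow_sub_le Finset.univ (by linarith : 0 ≤ p / 2) (by linarith) hn'.le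
      (fun i => (b * x i) ^ 2) (fun i => sq_nonneg _)
    have h3 : ((n : ℝ) + (b * R) ^ 2) ^ (p / 2) ≤ ((n : ℝ) + ∑ i, (b * x i) ^ 2) ^ (p / 2) := by
      refine Real.rpow_le_rpow (by positivity) ?_ (by linarith)
      simp_rw [mul_pow]
      rw [← Finset.mul_sum]
      gcongr
    linarith
  have hvol : volume ({x | R < ‖x‖} ∩ lpUnitBall p n) ≤
      volume {x : Fin n → ℝ | 1 ≤ K * ∏ i, f (b * x i)} := by
    have he := (EuclideanSpace.volume_preserving_symm_measurableEquiv_toLp (Fin n)).symm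
    rw [← he.measure_preimage_equiv]
    exact measure_mono hsub
  refine (ENNReal.toReal_mono hfin.ne hvol).trans ?_
  rw [one_mul] at hmarkov
  refine hmarkov.trans ?_
  rw [integral_const_mul, integral_fintype_prod_volume_eq_prod (fun _ x => f (b * x)),
    Finset.prod_const, Finset.card_univ, Fintype.card_fin, Measure.integral_comp_mul_left,
    abs_of_pos (inv_pos.2 hb), smul_eq_mul]
  have hJ0 : 0 ≤ ∫ x, f x := integral_nonneg fun x => (Real.exp_pos _).le
  have hK0 : 0 ≤ K := (Real.exp_pos _).le
  gcongr

/-- Concentration of the Euclidean norm on the `ℓ_p` ball, `1 ≤ p ≤ 2`. -/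
theorem lpBallMeasure_real_norm_gt_le {p : ℝ} (hp1 : 1 ≤ p) (hp2 : p ≤ 2) {n : ℕ} (hn : 1 ≤ n)
    {R : ℝ} (hR : 0 ≤ R) :
    (lpBallMeasure p n).real {x | R < ‖x‖} ≤
      Real.exp (54 * (n : ℝ) ^ (p / 2) - n * R ^ p / 4) := by
  have hn1 : (1 : ℝ) ≤ n := by exact_mod_cast hn
  have hn' : (0 : ℝ) < n := by linarith
  have hp0 : 0 < p := by linarith
  set m := (n : ℝ) / p with hm
  have hm0 : 0 < m := by positivity
  set b := m ^ (1 / p) with hb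
  have hb0 : 0 < b := by positivity
  have hbp : b ^ p = m := by
    rw [hb, ← Real.rpow_mul hm0.le, one_div_mul_cancel hp0.ne', Real.rpow_one]
  have hbn : b ^ n = m ^ m := by
    rw [hb, ← Real.rpow_natCast, ← Real.rpow_mul hm0.le]
    congr 1
    rw [hm]; ring
  set Z := 2 * Real.Gamma (1 / p + 1) with hZ
  have hZ0 : 0 < Z := by
    have := Real.Gamma_pos_of_pos (by positivity : 0 < 1 / p + 1)
    positivity
  have hG0 := Real.Gamma_pos_of_pos (by positivity : 0 < m + 1)
  set N := (n : ℝ) ^ (p / 2) with hN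
  have hN1 : 1 ≤ N := Real.one_le_rpow hn1 (by linarith)
  have key := volume_lpUnitBall_inter_le hp1 hp2 hn hR hb0
  have hψ : n * R ^ p / 2 - N ≤ ((n : ℝ) + (b * R) ^ 2) ^ (p / 2) - N := by
    have h1 : ((b * R) ^ 2) ^ (p / 2) ≤ ((n : ℝ) + (b * R) ^ 2) ^ (p / 2) :=
      Real.rpow_le_rpow (sq_nonneg _) (by linarith) (by linarith)
    have h2 : ((b * R) ^ 2) ^ (p / 2) = m * R ^ p := by
      rw [← Real.rpow_natCast, ← Real.rpow_mul (by positivity), ← hbp, ← Real.mul_rpow hb0.le hR]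
      congr 1
      push_cast; ring
    have h3 : (n : ℝ) / 2 ≤ m := by rw [hm]; gcongr
    have h4 := mul_le_mul_of_nonneg_right h3 (Real.rpow_nonneg hR p)
    linarith
  have h48 : (1 + 48 * (n : ℝ) ^ (p / 2 - 1)) ^ n ≤ Real.exp (48 * N) := by
    have h1 : 1 + 48 * (n : ℝ) ^ (p / 2 - 1) ≤ Real.exp (48 * (n : ℝ) ^ (p / 2 - 1)) := by
      rw [add_comm]; exact Real.add_one_le_exp _
    refine (pow_le_pow_left₀ (by positivity) h1 n).trans (le_of_eq ?_)
    rw [← Real.exp_nat_mul, Real.rpow_sub_one hn'.ne', hN]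
    congr 1
    field_simp
  have hΓ := Real.Gamma_add_one_le hm0
  have hm1 : m + 1 ≤ Real.exp (2 * N) := by
    refine le_trans ?_ (Real.natCast_add_one_le_exp hn (by linarith : 1 / 2 ≤ p / 2))
    have : m ≤ n := div_le_self hn'.le hp1
    linarith
  rw [measureReal_def, lpBallMeasure_apply, ENNReal.toReal_mul, ENNReal.toReal_inv,
    volume_lpUnitBall hp1 hn, ENNReal.toReal_ofReal (by positivity)]
  rw [hbp] at key
  refine (mul_le_mul_of_nonneg_left key (by positivity)).trans ?_
  have e1 : (Z ^ n / Real.Gamma (m + 1))⁻¹ *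
      (Real.exp (m - (((n : ℝ) + (b * R) ^ 2) ^ (p / 2) - N) / 2) *
        (b⁻¹ * (Z * (1 + 48 * (n : ℝ) ^ (p / 2 - 1)))) ^ n) =
      Real.Gamma (m + 1) * (b ^ n)⁻¹ * Real.exp (m - (((n : ℝ) + (b * R) ^ 2) ^ (p / 2) - N) / 2) *
        (1 + 48 * (n : ℝ) ^ (p / 2 - 1)) ^ n := by
    rw [mul_pow b⁻¹, mul_pow Z, inv_pow]
    field_simp
  rw [e1, hbn]
  have hmm : 0 < m ^ m := Real.rpow_pos_of_pos hm0 m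
  calc _ ≤ ((m + 1) * Real.exp 1 * (m ^ m * Real.exp (-m))) * (m ^ m)⁻¹ *
        Real.exp (m - (n * R ^ p / 2 - N) / 2) * Real.exp (48 * N) := by gcongr
    _ = (m + 1) * Real.exp (1 + -m + (m - (n * R ^ p / 2 - N) / 2) + 48 * N) := by
        rw [Real.exp_add, Real.exp_add, Real.exp_add]
        field_simp
    _ ≤ Real.exp (2 * N) * Real.exp (1 + -m + (m - (n * R ^ p / 2 - N) / 2) + 48 * N) := by gcongr
    _ ≤ _ := by
        rw [← Real.exp_add]
        refine Real.exp_le_exp.2 ?_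
        linarith

theorem proposition1 :
    ∃ c C : ℝ, 0 < c ∧ 0 < C ∧
      ∀ (p : ℝ) (n : ℕ), 1 ≤ p → p ≤ 2 → 1 ≤ n →
        ∀ A : Set (EuclideanSpace ℝ (Fin n)), NullMeasurableSet A volume →
          (lpBallMeasure p n).real A < Real.exp (-C * (n : ℝ) ^ (p / 2)) →
          ENNReal.ofReal (c * (n : ℝ) ^ (1 / p) * (lpBallMeasure p n).real A *
              Real.log (1 / (lpBallMeasure p n).real A) ^ (1 - 1 / p))
            ≤ lowerMinkowskiContent (lpBallMeasure p n) A := by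
  refine ⟨1 / 64, 60, by norm_num, by norm_num, fun p n hp1 hp2 hn A hA hsmall => ?_⟩
  have hprob := isProbabilityMeasure_lpBallMeasure hp1 hn
  have hp0 : 0 < p := by linarith
  have hn1 : (1 : ℝ) ≤ n := by exact_mod_cast hn
  have hn0 : (0 : ℝ) < n := by linarith
  set μ := lpBallMeasure p n with hμ
  set a := μ.real A with ha
  rcases (measureReal_nonneg : 0 ≤ μ.real A).eq_or_lt with h0 | hpos
  · rw [← ha] at h0
    simp [← h0]
  rw [← ha] at hpos
  set L := Real.log (1 / a) with hL
  have haL : a = Real.exp (-L) := by rw [hL, one_div, Real.log_inv, neg_neg, Real.exp_log hpos]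
  have hN1 : 1 ≤ (n : ℝ) ^ (p / 2) := Real.one_le_rpow hn1 (by linarith)
  have hLN : 60 * (n : ℝ) ^ (p / 2) < L := by
    rw [haL, Real.exp_lt_exp] at hsmall
    linarith
  have hL0 : 0 < L := by linarith
  set R := (8 * L / n) ^ (1 / p) with hR
  have hR0 : 0 < R := by positivity
  have hRp : R ^ p = 8 * L / n := by
    rw [hR, ← Real.rpow_mul (by positivity), one_div_mul_cancel hp0.ne', Real.rpow_one]
  have htail : μ.real {x | R < ‖x‖} ≤ a / 2 := by
    refine (lpBallMeasure_real_norm_gt_le hp1 hp2 hn hR0.le).trans ?_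
    have e : 54 * (n : ℝ) ^ (p / 2) - n * R ^ p / 4 ≤ -L + -1 := by
      have : n * R ^ p / 4 = 2 * L := by rw [hRp]; field_simp; norm_num
      linarith
    refine (Real.exp_le_exp.2 e).trans ?_
    rw [Real.exp_add, ← haL, div_eq_mul_inv, Real.exp_neg]
    gcongr
    linarith [Real.exp_one_gt_d9]
  have ha1 : a ≤ 1 := measureReal_le_one
  have hsplit : ∀ S, μ.real S ≤ μ.real (S ∩ Metric.closedBall 0 R) + μ.real {x | R < ‖x‖} := by
    intro S
    refine (measureReal_mono ?_).trans (measureReal_union_le _ _)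
    intro x hx
    rcases le_or_gt ‖x‖ R with h | h
    · exact Or.inl ⟨hx, mem_closedBall_zero_iff.2 h⟩
    · exact Or.inr h
  have hA2 : a / 2 ≤ μ.real (A ∩ Metric.closedBall 0 R) := by linarith [hsplit A]
  have hK2 : 1 / 2 ≤ μ.real (Metric.closedBall 0 R) := by
    have := hsplit Set.univ
    rw [Set.univ_inter, probReal_univ] at this
    linarith
  have hAa : μ.real (A ∩ Metric.closedBall 0 R) ≤ a := measureReal_mono Set.inter_subset_left
  have hApos : 0 < μ.real (A ∩ Metric.closedBall 0 R) := by linarith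
  refine le_trans (ENNReal.ofReal_le_ofReal ?_)
    (le_lowerMinkowskiContent_lpBallMeasure hp1 hn hA hR0 hApos)
  have hlog : L / 2 ≤ Real.log (μ.real (Metric.closedBall 0 R) /
      μ.real (A ∩ Metric.closedBall 0 R)) := by
    have h1 : (1 / a) * (1 / 2) ≤ μ.real (Metric.closedBall 0 R) /
        μ.real (A ∩ Metric.closedBall 0 R) := by
      rw [div_mul_eq_mul_div, one_mul]
      gcongr
    refine le_trans ?_ (Real.log_le_log (by positivity) h1)
    rw [Real.log_mul (by positivity) (by norm_num), ← hL, one_div, Real.log_inv]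
    linarith [Real.log_two_lt_d9]
  have hRle : R * (n : ℝ) ^ (1 / p) ≤ 8 * L ^ (1 / p) := by
    rw [hR, ← Real.mul_rpow (by positivity) hn0.le, div_mul_cancel₀ _ hn0.ne',
      Real.mul_rpow (by norm_num) hL0.le]
    gcongr
    calc (8 : ℝ) ^ (1 / p) ≤ 8 ^ (1 : ℝ) :=
          Real.rpow_le_rpow_of_exponent_le (by norm_num) ((div_le_one hp0).2 hp1)
      _ = 8 := Real.rpow_one 8
  calc 1 / 64 * (n : ℝ) ^ (1 / p) * a * L ^ (1 - 1 / p) ≤ a / 2 * (L / 2) / (2 * R) := by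
        rw [le_div_iff₀ (by positivity)]
        have hLL : L ^ (1 - 1 / p) * L ^ (1 / p) = L := by
          rw [← Real.rpow_add hL0, sub_add_cancel, Real.rpow_one]
        have hLq := Real.rpow_nonneg hL0.le (1 - 1 / p)
        calc 1 / 64 * (n : ℝ) ^ (1 / p) * a * L ^ (1 - 1 / p) * (2 * R)
            = 1 / 32 * a * L ^ (1 - 1 / p) * (R * (n : ℝ) ^ (1 / p)) := by ring
          _ ≤ 1 / 32 * a * L ^ (1 - 1 / p) * (8 * L ^ (1 / p)) := by gcongr
          _ = a / 2 * ((L ^ (1 - 1 / p) * L ^ (1 / p)) / 2) := by ring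
          _ = a / 2 * (L / 2) := by rw [hLL]
    _ ≤ _ := by gcongr
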